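/- Let $(X_i)_{i\in\mathbb Z}$ and $(C_i)_{i\in\mathbb Z}$ be two strictly stationary real-valued processes on a probability space, independent of each other, with $\mathbb E X_0=0$ and with $(C_i)$ non-negative and bounded ($0\le C_i\le B$ almost surely, for some constant $B$). Put $Y_i=C_iX_i$, $\overline Y_N=\frac1N\sum_{i=1}^N Y_i$, $\gamma_X(\ell)=\mathrm{Cov}(X_0,X_\ell)$, and define the Parzen estimator $$\tilde\gamma_{X,N}(\ell)=\frac{\sum_{i=1}^{N-\ell}(Y_i-\overline Y_N)(Y_{i+\ell}-\overline Y_N)}{\sum_{i=1}^{N-\ell}C_iC_{i+\ell}},\qquad \ell\in\mathbb N.$$ For $f:\mathbb R^p\to\mathbb R$ let $\mathrm{Lip}\,f=\sup_{x\ne y}|f(x)-f(y)|/\sum_{i=1}^p|x_i-y_i|$. Given $\psi:\mathbb N^2\times(\mathbb R^+)^2\to\mathbb R^+$ and a sequence $(\epsilon(r))_{r\ge0}$ decreasing to $0$, a process $(Z_i)_{i\in\mathbb Z}$ is called $(\epsilon,\psi)$-weakly dependent if $$|\mathrm{Cov}(f(Z_{s_1},\dots,Z_{s_u}),g(Z_{t_1},\dots,Z_{t_v}))|\le\psi(u,v,\mathrm{Lip}\,f,\mathrm{Lip}\,g)\,\epsilon(r)$$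 for all $u,v\ge1$, all $f:\mathbb R^u\to\mathbb R$, $g:\mathbb R^v\to\mathbb R$ with $\|f\|_\infty,\|g\|_\infty\le1$ and $\mathrm{Lip}\,f,\mathrm{Lip}\,g<\infty$, all integers $r\ge0$ and all $s_1\le\dots\le s_u\le s_u+r\le t_1\le\dots\le t_v$. It is $\theta$-, $\kappa$- or $\lambda$-weakly dependent, with the sequence $\epsilon$ then written $\theta$, $\kappa$ or $\lambda$, when $\psi(u,v,a,b)$ is $vb$, $uvab$ or $uvab+ua+vb$, respectively. Assume that one of the following three conditions holds. 1. There are $\delta>0$ and $r>1+\delta$ such that $\mathbb E|X_0|^{2+\delta}<\infty$, and $(X_i)$ and $(C_i)$ are $\theta$-weakly dependent with sequences $\theta_X$ and $\theta_C$, where for both $\theta=\theta_X$ and $\theta=\theta_C$ $$\sum_{i\ge0} i^{\frac{r(\delta-1)+1}{r-(1+\delta)}}\,\theta(i)^{\frac{\delta}{\delta+1}}<\infty$$ (the term $i=0$ is irrelevant and may be omitted). 2. There are $m>4$ and $\kappa>\frac m{m-2}\bigl(2+\frac1{m-2}\bigr)$ such that $\mathbb E|X_0|^m<\infty$, and $(X_i)$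 and $(C_i)$ are $\kappa$-weakly dependent with sequences $\kappa_X(n)=\mathcal O(n^{-\kappa})$ and $\kappa_C(n)=\mathcal O(n^{-\kappa})$ as $n\to\infty$. 3. There are $m>4$ and $\lambda>\frac m{m-2}\bigl(4+\frac1{m-2}\bigr)$ such that $\mathbb E|X_0|^m<\infty$, and $(X_i)$ and $(C_i)$ are $\lambda$-weakly dependent with sequences $\lambda_X(n)=\mathcal O(n^{-\lambda})$ and $\lambda_C(n)=\mathcal O(n^{-\lambda})$ as $n\to\infty$. Then for every $\ell\in\mathbb N$ with $\mathbb E[C_0C_\ell]>0$, $$\tilde\gamma_{X,N}(\ell)\longrightarrow\gamma_X(\ell)\quad\text{almost surely as }N\to\infty .$$ -/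

import Mathlib

open MeasureTheory ProbabilityTheory Filter Topology Asymptotics
open scoped ENNReal

/-- Strict stationarity of a process indexed by `ℤ`: the law of the whole path is invariant
under every time shift. -/
def IsStrictlyStationary {Ω : Type*} [MeasurableSpace Ω] (μ : Measure Ω) (Z : ℤ → Ω → ℝ) :
    Prop :=
  ∀ k : ℤ, μ.map (fun ω (i : ℤ) => Z (i + k) ω) = μ.map (fun ω (i : ℤ) => Z i ω)

/-- The Lipschitz coefficient `Lip f`, possibly infinite, of `f : ℝᵖ → ℝ` with respect to the
distance `|x₁ - y₁| + ⋯ + |xₚ - yₚ|`. -/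
noncomputable def lipCoeff {p : ℕ} (f : (Fin p → ℝ) → ℝ) : ℝ≥0∞ :=
  ⨆ (x : Fin p → ℝ) (y : Fin p → ℝ) (_ : x ≠ y),
    ENNReal.ofReal (|f x - f y| / ∑ i, |x i - y i|)

/-- The process `Z` is `(ε, ψ)`-weakly dependent: `ε` decreases to zero, and the covariance of
`f (Z_{s₁}, …, Z_{sᵤ})` and `g (Z_{t₁}, …, Z_{tᵥ})` is at most `ψ(u, v, Lip f, Lip g) ε(r)`
whenever `s₁ ≤ ⋯ ≤ sᵤ ≤ sᵤ + r ≤ t₁ ≤ ⋯ ≤ tᵥ` and `f`, `g` are Lipschitz functions bounded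
by one. -/
structure IsWeaklyDependent {Ω : Type*} [MeasurableSpace Ω] (μ : Measure Ω) (Z : ℤ → Ω → ℝ)
    (ψ : ℕ → ℕ → ℝ → ℝ → ℝ) (ε : ℕ → ℝ) : Prop where
  antitone : Antitone ε
  tendsto_zero : Tendsto ε atTop (𝓝 0)
  abs_cov_le : ∀ (u v : ℕ), 0 < u → 0 < v →
    ∀ (f : (Fin u → ℝ) → ℝ) (g : (Fin v → ℝ) → ℝ),
      (∀ x, |f x| ≤ 1) → (∀ x, |g x| ≤ 1) → lipCoeff f < ⊤ → lipCoeff g < ⊤ →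
    ∀ (r : ℕ) (s : Fin u → ℤ) (t : Fin v → ℤ), Monotone s → Monotone t →
      (∀ i j, s i + (r : ℤ) ≤ t j) →
    |cov[fun ω => f (fun i => Z (s i) ω), fun ω => g (fun j => Z (t j) ω); μ]|
      ≤ ψ u v (lipCoeff f).toReal (lipCoeff g).toReal * ε r

/-- The function `ψ` of `θ`-weak dependence. -/
def psiTheta (_u v : ℕ) (_a b : ℝ) : ℝ := v * b

/-- The function `ψ` of `κ`-weak dependence. -/
def psiKappa (u v : ℕ) (a b : ℝ) : ℝ := u * v * a * b

/-- The function `ψ` of `λ`-weak dependence. -/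
def psiLambda (u v : ℕ) (a b : ℝ) : ℝ := u * v * a * b + u * a + v * b

/-- The sample mean `(Y₁ + ⋯ + Y_N) / N`. -/
noncomputable def sampleMean {Ω : Type*} (Y : ℤ → Ω → ℝ) (N : ℕ) (ω : Ω) : ℝ :=
  (∑ i ∈ Finset.Icc 1 N, Y (i : ℤ) ω) / N

/-- The Parzen estimator of the lag `ℓ` autocovariance of `X`, computed from the modulating
process `C` and the observations `Yᵢ = Cᵢ Xᵢ` up to time `N`. -/
noncomputable def parzenEstimator {Ω : Type*} (X C : ℤ → Ω → ℝ) (ℓ N : ℕ) (ω : Ω) : ℝ :=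
  let Y : ℤ → Ω → ℝ := fun i ω => C i ω * X i ω
  (∑ i ∈ Finset.Icc 1 (N - ℓ),
      (Y (i : ℤ) ω - sampleMean Y N ω) * (Y ((i : ℤ) + ℓ) ω - sampleMean Y N ω)) /
    ∑ i ∈ Finset.Icc 1 (N - ℓ), C (i : ℤ) ω * C ((i : ℤ) + ℓ) ω

/-! By independence the pair (X, C) has on path space the product of the two path laws, which the
product shift preserves. Once the centred products are expanded, the estimator is built from time
averages of x₀x_ℓc₀c_ℓ, of x₀c₀ (also translated by ℓ) and of c₀c_ℓ. It suffices that these converge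
almost surely to their means γ_X(ℓ)E[C₀C_ℓ], 0 and E[C₀C_ℓ].

Decorrelation plays the role of ergodicity. Weak dependence makes autocorrelations of bounded
Lipschitz functions of two coordinates factorize in the limit
(`IsWeaklyDependent.isMixingObservable`). Truncation exhibits x₀, x₀x_ℓ and their analogues for C as
L¹ limits of such observables, and this property passes to products over the two factors
(`IsMixingLimit.prod_mul`). Each of the three conditions supplies the input: a finite second moment
and coefficients tending to zero.

The pointwise theorem is `ae_tendsto_birkhoffAverage`. Let u be a mixing observable with mean m,
close to h in L¹, and let A average u along a sparse progression of times. Decorrelation makes A - m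
small in L¹, while A - u is a combination of bounded coboundaries, whose Birkhoff averages vanish at
every point. So h - ∫h is small in L¹ up to a negligible term, and the weak type maximal inequality
turns smallness in L¹ into almost sure convergence. -/

/-! ### Maximal ergodic inequality. -/

section MaximalErgodic

variable {α : Type*}

/-- The running maximum `max (0, S₁ h, …, Sₙ h)` of the Birkhoff sums of `h`. -/
noncomputable def birkhoffMax (T : α → α) (h : α → ℝ) : ℕ → α → ℝ
  | 0 => fun _ => 0
  | n + 1 => fun x => max 0 (h x + birkhoffMax T h n (T x))

theorem birkhoffMax_nonneg (T : α → α) (h : α → ℝ) (n : ℕ) (x : α) :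
    0 ≤ birkhoffMax T h n x := by
  cases n with
  | zero => exact le_rfl
  | succ n => exact le_max_left _ _

theorem birkhoffMax_le_succ (T : α → α) (h : α → ℝ) (n : ℕ) (x : α) :
    birkhoffMax T h n x ≤ birkhoffMax T h (n + 1) x := by
  induction n generalizing x with
  | zero => exact le_max_left _ _
  | succ n ih =>
    change max 0 (h x + birkhoffMax T h n (T x)) ≤ max 0 (h x + birkhoffMax T h (n + 1) (T x))
    have := ih (T x)
    gcongr

theorem birkhoffMax_mono (T : α → α) (h : α → ℝ) (x : α) :
    Monotone fun n => birkhoffMax T h n x :=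
  monotone_nat_of_le_succ fun n => birkhoffMax_le_succ T h n x

theorem birkhoffSum_le_birkhoffMax (T : α → α) (h : α → ℝ) (n : ℕ) (x : α) :
    birkhoffSum T h n x ≤ birkhoffMax T h n x := by
  induction n generalizing x with
  | zero => simp [birkhoffMax]
  | succ n ih =>
    rw [birkhoffSum_succ']
    exact (add_le_add_right (ih (T x)) _).trans (le_max_right _ _)

/-- Garsia's inequality: a positive maximum is attained by a nonempty sum, which splits off its
first term. -/
theorem birkhoffMax_le_of_pos (T : α → α) (h : α → ℝ) (n : ℕ) (x : α)
    (hx : 0 < birkhoffMax T h n x) :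
    birkhoffMax T h n x ≤ h x + birkhoffMax T h n (T x) := by
  cases n with
  | zero => exact absurd hx (lt_irrefl _)
  | succ n =>
    have h1 : birkhoffMax T h (n + 1) x = h x + birkhoffMax T h n (T x) := by
      change max 0 _ = _
      refine max_eq_right (le_of_not_ge fun h0 => ?_)
      have : birkhoffMax T h (n + 1) x = 0 := max_eq_left h0
      linarith
    rw [h1]
    exact add_le_add_right (birkhoffMax_le_succ T h n (T x)) _

variable [MeasurableSpace α] {μ : Measure α} {T : α → α} {h : α → ℝ}

theorem measurable_birkhoffMax (hT : Measurable T) (hh : Measurable h) (n : ℕ) :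
    Measurable (birkhoffMax T h n) := by
  induction n with
  | zero => exact measurable_const
  | succ n ih => exact measurable_const.max (hh.add (ih.comp hT))

theorem integrable_birkhoffMax (hT : MeasurePreserving T μ μ) (hh : Integrable h μ) (n : ℕ) :
    Integrable (birkhoffMax T h n) μ := by
  induction n with
  | zero => exact integrable_zero _ _ _
  | succ n ih =>
    exact (integrable_zero _ _ _).sup (hh.add (hT.integrable_comp_of_integrable ih))

/-- The maximal ergodic theorem. -/
theorem setIntegral_birkhoffMax_pos_nonneg (hT : MeasurePreserving T μ μ) (hm : Measurable h)
    (hh : Integrable h μ) (n : ℕ) : 0 ≤ ∫ x in {x | 0 < birkhoffMax T h n x}, h x ∂μ := by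
  have hM := integrable_birkhoffMax hT hh n
  have hMT : Integrable (fun x => birkhoffMax T h n (T x)) μ := hT.integrable_comp_of_integrable hM
  have hmeas : MeasurableSet {x | 0 < birkhoffMax T h n x} :=
    measurableSet_lt measurable_const (measurable_birkhoffMax hT.measurable hm n)
  have hcomp : ∫ x, birkhoffMax T h n (T x) ∂μ = ∫ x, birkhoffMax T h n x ∂μ := by
    have := integral_map (μ := μ) hT.measurable.aemeasurable
      (f := birkhoffMax T h n) (by rw [hT.map_eq]; exact hM.aestronglyMeasurable)
    rw [hT.map_eq] at this
    exact this.symm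
  rw [← integral_indicator hmeas]
  -- With M the running maximum, M - M∘T has integral zero by invariance. It is at most h where M >
  -- 0, and at most 0 where M = 0.
  calc (0 : ℝ) = ∫ x, (birkhoffMax T h n x - birkhoffMax T h n (T x)) ∂μ := by
        rw [integral_sub hM hMT, hcomp, sub_self]
    _ ≤ _ := by
        refine integral_mono (hM.sub hMT) (hh.indicator hmeas) fun x => ?_
        by_cases hx : 0 < birkhoffMax T h n x
        · rw [Set.indicator_of_mem (by exact hx)]
          have := birkhoffMax_le_of_pos T h n x hx
          simp only
          linarith
        · rw [Set.indicator_of_notMem (by exact hx)]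
          have := birkhoffMax_nonneg T h n (T x)
          simp only
          linarith

/-- The weak type maximal inequality for Birkhoff averages. -/
theorem measure_exists_lt_birkhoffAverage_le [IsProbabilityMeasure μ]
    (hT : MeasurePreserving T μ μ) {f : α → ℝ} (hm : Measurable f) (hf : Integrable f μ)
    (h0 : ∀ x, 0 ≤ f x) {c : ℝ} (hc : 0 < c) :
    μ {x | ∃ n : ℕ, c < birkhoffAverage ℝ T f n x} ≤ ENNReal.ofReal ((∫ x, f x ∂μ) / c) := by
  set g : α → ℝ := fun x => f x - c
  have hgm : Measurable g := hm.sub measurable_const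
  have hg : Integrable g μ := hf.sub (integrable_const c)
  have hbound : ∀ n, μ {x | 0 < birkhoffMax T g n x} ≤ ENNReal.ofReal ((∫ x, f x ∂μ) / c) := by
    intro n
    have h1 := setIntegral_birkhoffMax_pos_nonneg hT hgm hg n
    rw [integral_sub hf.integrableOn (integrable_const c).integrableOn] at h1
    simp only [integral_const, smul_eq_mul, measureReal_restrict_apply_univ] at h1
    have h2 := setIntegral_le_integral (s := {x | 0 < birkhoffMax T g n x}) hf (ae_of_all _ h0)
    rw [← ofReal_measureReal]
    refine ENNReal.ofReal_le_ofReal ?_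
    rw [le_div_iff₀ hc]
    linarith
  have hsub : {x | ∃ n : ℕ, c < birkhoffAverage ℝ T f n x} ⊆
      ⋃ n, {x | 0 < birkhoffMax T g n x} := by
    rintro x ⟨n, hn⟩
    refine Set.mem_iUnion.2 ⟨n, lt_of_lt_of_le ?_ (birkhoffSum_le_birkhoffMax T g n x)⟩
    have hn0 : 0 < n := by
      rcases Nat.eq_zero_or_pos n with rfl | h
      · simp at hn; linarith
      · exact h
    have hn' : (0 : ℝ) < n := by exact_mod_cast hn0
    have : birkhoffSum T g n x = birkhoffSum T f n x - n * c := by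
      simp [birkhoffSum, g, Finset.sum_sub_distrib]
    rw [this]
    rw [birkhoffAverage, smul_eq_mul, inv_mul_eq_div, lt_div_iff₀ hn'] at hn
    linarith
  refine (measure_mono hsub).trans ?_
  rw [Monotone.measure_iUnion]
  · exact iSup_le hbound
  · exact fun a b hab x hx => lt_of_lt_of_le hx (birkhoffMax_mono T g x hab)

/-- A maximal inequality turns approximate domination into almost sure convergence. -/
theorem ae_tendsto_zero_of_le_birkhoffAverage [IsProbabilityMeasure μ]
    (hT : MeasurePreserving T μ μ) (a : ℕ → α → ℝ)
    (ha : ∀ ε > 0, ∃ (f : α → ℝ) (e : ℕ → α → ℝ), Measurable f ∧ Integrable f μ ∧ (∀ x, 0 ≤ f x) ∧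
      ∫ x, f x ∂μ ≤ ε ∧ (∀ x, Tendsto (fun n => e n x) atTop (𝓝 0)) ∧
      ∀ᶠ n in atTop, ∀ x, |a n x| ≤ birkhoffAverage ℝ T f n x + e n x) :
    ∀ᵐ x ∂μ, Tendsto (fun n => a n x) atTop (𝓝 0) := by
  have key : ∀ c : ℝ, 0 < c → ∀ᵐ x ∂μ, ∀ᶠ n in atTop, |a n x| ≤ 2 * c := by
    intro c hc
    rw [ae_iff]
    refine le_antisymm (le_of_forall_gt fun b hb => ?_) (zero_le)
    obtain ⟨b', hb'0, hb'⟩ := ENNReal.lt_iff_exists_real_btwn.1 hb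
    have hb'pos : 0 < b' := by
      by_contra hneg
      simp [ENNReal.ofReal_of_nonpos (not_lt.1 hneg)] at hb'
    -- With ∫ f ≤ b'c the maximal inequality bounds the exceptional set by b'; off it both terms of
    -- the domination are eventually at most c.
    obtain ⟨f, e, hm, hf, h0, hε, he, hle⟩ := ha (b' * c) (by positivity)
    refine lt_of_le_of_lt ?_ hb'.2
    refine (measure_mono ?_).trans
      ((measure_exists_lt_birkhoffAverage_le hT hm hf h0 hc).trans
        (ENNReal.ofReal_le_ofReal ((div_le_iff₀ hc).2 hε)))
    intro x hx
    by_contra hcon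
    refine hx ?_
    have hcon' : ∀ n, birkhoffAverage ℝ T f n x ≤ c := fun n =>
      not_lt.1 fun hlt => hcon ⟨n, hlt⟩
    filter_upwards [hle, (he x).eventually_le_const hc] with n h1 h2
    have := h1 x
    have := hcon' n
    linarith
  have hall : ∀ᵐ x ∂μ, ∀ k : ℕ, ∀ᶠ n in atTop, |a n x| ≤ 2 * (1 / ((k : ℝ) + 1)) :=
    ae_all_iff.2 fun k => key _ (by positivity)
  filter_upwards [hall] with x hx
  rw [Metric.tendsto_atTop]
  intro ε hε
  obtain ⟨k, hk⟩ := exists_nat_one_div_lt (half_pos hε)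
  obtain ⟨N, hN⟩ := eventually_atTop.1 (hx k)
  refine ⟨N, fun n hn => ?_⟩
  have := hN n hn
  rw [Real.dist_eq, sub_zero]
  linarith

end MaximalErgodic

/-! ### Pointwise ergodic theorem from decay of correlations. -/

section Correlations

theorem tendsto_birkhoffAverage_iterate_sub {α : Type*} {T : α → α} {u : α → ℝ} (hb : ∃ K, ∀ x, |u x| ≤ K) (j : ℕ) (x : α) :
    Tendsto (fun n => birkhoffAverage ℝ T u n (T^[j] x) - birkhoffAverage ℝ T u n x) atTop
      (𝓝 0) := by
  obtain ⟨K, hK⟩ := hb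
  have hbdd : Bornology.IsBounded (Set.range u) :=
    isBounded_iff_forall_norm_le.2 ⟨K, by rintro _ ⟨x, rfl⟩; exact hK x⟩
  induction j with
  | zero => simp
  | succ j ih =>
    have := (tendsto_birkhoffAverage_apply_sub_birkhoffAverage' ℝ hbdd T (T^[j] x)).add ih
    simpa [Function.iterate_succ_apply'] using this

variable {α : Type*} [MeasurableSpace α]

/-- `u` is a bounded measurable observable whose autocorrelations along `T` factorize in the
limit. -/
structure IsMixingObservable (T : α → α) (μ : Measure α) (u : α → ℝ) : Prop where
  measurable : Measurable u
  bounded : ∃ K, ∀ x, |u x| ≤ K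
  tendsto : Tendsto (fun n => ∫ x, u x * u (T^[n] x) ∂μ) atTop (𝓝 ((∫ x, u x ∂μ) ^ 2))

variable {μ : Measure α} {T : α → α} {u : α → ℝ}

theorem IsMixingObservable.integrable [IsFiniteMeasure μ] (hu : IsMixingObservable T μ u) :
    Integrable u μ := by
  obtain ⟨K, hK⟩ := hu.bounded
  exact Integrable.of_bound hu.measurable.aestronglyMeasurable K (ae_of_all _ hK)

/-- Averages along a sufficiently sparse arithmetic progression of times are close to the mean. -/
theorem IsMixingObservable.exists_average_close [IsProbabilityMeasure μ]
    (hT : MeasurePreserving T μ μ) (hu : IsMixingObservable T μ u) {ε : ℝ} (hε : 0 < ε) :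
    ∃ K d : ℕ, 0 < K ∧
      ∫ x, |(K : ℝ)⁻¹ * ∑ k ∈ Finset.range K, u (T^[k * d] x) - ∫ y, u y ∂μ| ∂μ ≤ ε := by
  obtain ⟨B, hB⟩ := hu.bounded
  have hui := hu.integrable
  set m := ∫ y, u y ∂μ with hm
  set w : α → ℝ := fun x => u x - m with hw
  have hwm : Measurable w := hu.measurable.sub measurable_const
  have hB0 : 0 ≤ B := by
    have : Nonempty α := nonempty_of_isProbabilityMeasure μ
    exact (abs_nonneg _).trans (hB (Classical.arbitrary α))
  have hwb : ∀ x, |w x| ≤ B + |m| := fun x => (abs_sub _ _).trans (add_le_add_left (hB x) _)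
  have hcompi : ∀ j, ∫ x, u (T^[j] x) ∂μ = m := fun j => by
    have hj := hT.iterate j
    have := integral_map (μ := μ) hj.measurable.aemeasurable
      (f := u) (by rw [hj.map_eq]; exact hui.aestronglyMeasurable)
    rw [hj.map_eq] at this
    exact this.symm
  have hTm : ∀ j, Measurable (T^[j]) := fun j => (hT.iterate j).measurable
  have hprodi : ∀ i j, Integrable (fun x => w (T^[i] x) * w (T^[j] x)) μ := fun i j =>
    Integrable.of_bound ((hwm.comp (hTm i)).mul (hwm.comp (hTm j))).aestronglyMeasurable
      ((B + |m|) * (B + |m|)) (ae_of_all _ fun x => by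
        rw [Real.norm_eq_abs, abs_mul]
        exact mul_le_mul (hwb _) (hwb _) (abs_nonneg _) (by positivity))
  have hdecay : Tendsto (fun n => ∫ x, w x * w (T^[n] x) ∂μ) atTop (𝓝 0) := by
    have : ∀ n, ∫ x, w x * w (T^[n] x) ∂μ = ∫ x, u x * u (T^[n] x) ∂μ - m ^ 2 := by
      intro n
      have hun : Integrable (fun x => u (T^[n] x)) μ :=
        (hT.iterate n).integrable_comp_of_integrable hui
      have huu : Integrable (fun x => u x * u (T^[n] x)) μ :=
        hui.mul_bdd (c := B) (hu.measurable.comp (hTm n)).aestronglyMeasurable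
          (ae_of_all _ fun x => hB _)
      have e : (fun x => w x * w (T^[n] x)) =
          fun x => u x * u (T^[n] x) - m * u (T^[n] x) - m * u x + m ^ 2 := by
        funext x; simp only [hw]; ring
      have i1 : Integrable (fun x => u x * u (T^[n] x) - m * u (T^[n] x)) μ :=
        huu.sub (hun.const_mul m)
      have i2 : Integrable (fun x => u x * u (T^[n] x) - m * u (T^[n] x) - m * u x) μ :=
        i1.sub (hui.const_mul m)
      rw [e, integral_add i2 (integrable_const _), integral_sub i1 (hui.const_mul m),
        integral_sub huu (hun.const_mul m), integral_const_mul, integral_const_mul, hcompi n]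
      simp [← hm]; ring
    simp_rw [this]
    have := hu.tendsto.sub_const (m ^ 2)
    rwa [← hm, sub_self] at this
  -- The second moment of the average splits evenly: K makes the diagonal contribute at most ε²/2,
  -- and the spacing d makes each off-diagonal correlation at most ε²/2.
  obtain ⟨K, hK⟩ := exists_nat_gt ((B + |m|) ^ 2 / (ε ^ 2 / 2))
  have hε2 : 0 < ε ^ 2 / 2 := by positivity
  have hK0 : (0 : ℝ) < K := lt_of_le_of_lt (by positivity) hK
  obtain ⟨d, hd⟩ := eventually_atTop.1
    ((tendsto_order.1 hdecay.abs).2 (ε ^ 2 / 2) (by simpa using hε2))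
  have hshift : ∀ i j, i ≤ j → ∫ x, w (T^[i] x) * w (T^[j] x) ∂μ =
      ∫ x, w x * w (T^[j - i] x) ∂μ := by
    intro i j hij
    have hi := hT.iterate i
    have := integral_map (μ := μ) hi.measurable.aemeasurable
      (f := fun x => w x * w (T^[j - i] x)) (hwm.mul (hwm.comp (hTm _))).aestronglyMeasurable
    rw [hi.map_eq] at this
    rw [this]
    simp_rw [← Function.iterate_add_apply, Nat.sub_add_cancel hij]
  have hoff : ∀ i j, i < j → |∫ x, w (T^[i * d] x) * w (T^[j * d] x) ∂μ| ≤ ε ^ 2 / 2 := by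
    intro i j hij
    rw [hshift _ _ (Nat.mul_le_mul_right d hij.le), ← Nat.sub_mul]
    exact (hd _ (Nat.le_mul_of_pos_left d (Nat.sub_pos_of_lt hij))).le
  have hdiag : ∀ i, |∫ x, w (T^[i] x) * w (T^[i] x) ∂μ| ≤ (B + |m|) ^ 2 := by
    intro i
    have := norm_integral_le_of_norm_le_const (μ := μ) (f := fun x => w (T^[i] x) * w (T^[i] x))
      (C := (B + |m|) ^ 2) (ae_of_all _ fun x => by
        rw [Real.norm_eq_abs, abs_mul, pow_two]
        exact mul_le_mul (hwb _) (hwb _) (abs_nonneg _) (by positivity))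
    simpa using this
  have hpair : ∀ i j, ∫ x, w (T^[i * d] x) * w (T^[j * d] x) ∂μ ≤
      ε ^ 2 / 2 + if i = j then (B + |m|) ^ 2 else 0 := by
    intro i j
    rcases lt_trichotomy i j with hij | rfl | hij
    · rw [if_neg hij.ne, add_zero]
      exact (le_abs_self _).trans (hoff i j hij)
    · rw [if_pos rfl]
      have := (le_abs_self _).trans (hdiag (i * d))
      linarith
    · rw [if_neg hij.ne', add_zero]
      simp_rw [mul_comm (w (T^[i * d] _))]
      exact (le_abs_self _).trans (hoff j i hij)
  set A : α → ℝ := fun x => (K : ℝ)⁻¹ * ∑ k ∈ Finset.range K, u (T^[k * d] x) - m with hA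
  have hAw : ∀ x, A x = (K : ℝ)⁻¹ * ∑ k ∈ Finset.range K, w (T^[k * d] x) := by
    intro x
    simp only [hA, hw, Finset.sum_sub_distrib, Finset.sum_const, Finset.card_range, nsmul_eq_mul]
    field_simp
  have hAsq : ∫ x, A x ^ 2 ∂μ ≤ ε ^ 2 := by
    have e : (fun x => A x ^ 2) = fun x => (K : ℝ)⁻¹ ^ 2 *
        ∑ i ∈ Finset.range K, ∑ j ∈ Finset.range K, w (T^[i * d] x) * w (T^[j * d] x) := by
      funext x
      rw [hAw, mul_pow, pow_two (∑ k ∈ _, _), Finset.sum_mul_sum]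
    rw [e, integral_const_mul, integral_finsetSum _
      (fun i _ => integrable_finsetSum _ fun j _ => hprodi _ _)]
    simp_rw [integral_finsetSum _ (fun j _ => hprodi _ (j * d))]
    have h1 : ∑ i ∈ Finset.range K, ∑ j ∈ Finset.range K,
        ∫ x, w (T^[i * d] x) * w (T^[j * d] x) ∂μ ≤
        K * (K * (ε ^ 2 / 2)) + K * (B + |m|) ^ 2 := by
      calc _ ≤ ∑ i ∈ Finset.range K, ∑ j ∈ Finset.range K,
            (ε ^ 2 / 2 + if i = j then (B + |m|) ^ 2 else 0) :=
            Finset.sum_le_sum fun i _ => Finset.sum_le_sum fun j _ => hpair i j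
        _ = _ := by
            simp only [Finset.sum_add_distrib, Finset.sum_const, Finset.card_range, nsmul_eq_mul,
              Finset.sum_ite_eq, ]
            congr 1
            rw [Finset.sum_congr rfl fun i hi => if_pos hi]
            simp
    rw [div_lt_iff₀ hε2] at hK
    calc _ ≤ (K : ℝ)⁻¹ ^ 2 * (K * (K * (ε ^ 2 / 2)) + K * (B + |m|) ^ 2) := by gcongr
      _ = ε ^ 2 / 2 + (K : ℝ)⁻¹ * (B + |m|) ^ 2 := by field_simp
      _ ≤ ε ^ 2 / 2 + (K : ℝ)⁻¹ * (K * (ε ^ 2 / 2)) := by gcongr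
      _ = ε ^ 2 := by field_simp; norm_num
  have hAm : Measurable A :=
    (measurable_const.mul (Finset.measurable_fun_sum _ fun k _ =>
      hu.measurable.comp (hTm _))).sub measurable_const
  have hA2i : Integrable (fun x => A x ^ 2) μ := by
    have e : (fun x => A x ^ 2) = fun x => (K : ℝ)⁻¹ ^ 2 *
        ∑ i ∈ Finset.range K, ∑ j ∈ Finset.range K, w (T^[i * d] x) * w (T^[j * d] x) := by
      funext x
      rw [hAw, mul_pow, pow_two (∑ k ∈ _, _), Finset.sum_mul_sum]
    rw [e]
    exact (integrable_finsetSum _ fun i _ => integrable_finsetSum _ fun j _ =>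
      hprodi _ _).const_mul _
  refine ⟨K, d, by exact_mod_cast hK0, ?_⟩
  change ∫ x, |A x| ∂μ ≤ ε
  -- The arithmetic-geometric mean inequality converts the L² bound into an L¹ bound.
  have hbd : ∀ x, |A x| ≤ (A x ^ 2 / ε + ε) / 2 := by
    intro x
    rw [← sq_abs (A x), le_div_iff₀ two_pos, div_add' _ _ _ hε.ne', le_div_iff₀ hε]
    nlinarith [sq_nonneg (|A x| - ε)]
  have hri : Integrable (fun x => (A x ^ 2 / ε + ε) / 2) μ :=
    ((hA2i.div_const ε).add (integrable_const ε)).div_const 2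
  calc ∫ x, |A x| ∂μ ≤ ∫ x, (A x ^ 2 / ε + ε) / 2 ∂μ :=
        integral_mono_of_nonneg (ae_of_all _ fun x => abs_nonneg _) hri (ae_of_all _ hbd)
    _ = ((∫ x, A x ^ 2 ∂μ) / ε + ε) / 2 := by
        rw [integral_div, integral_add (hA2i.div_const ε) (integrable_const ε), integral_div]
        simp
    _ ≤ (ε ^ 2 / ε + ε) / 2 := by gcongr
    _ = ε := by field_simp; norm_num

/-- A pointwise ergodic theorem for observables that are `L¹` limits of mixing observables. -/
theorem ae_tendsto_birkhoffAverage [IsProbabilityMeasure μ] (hT : MeasurePreserving T μ μ)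
    {h : α → ℝ} (hm : Measurable h) (hh : Integrable h μ)
    (happ : ∀ ε > 0, ∃ u, IsMixingObservable T μ u ∧ ∫ x, |h x - u x| ∂μ ≤ ε) :
    ∀ᵐ x ∂μ, Tendsto (fun n => birkhoffAverage ℝ T h n x) atTop (𝓝 (∫ x, h x ∂μ)) := by
  have main : ∀ᵐ x ∂μ,
      Tendsto (fun n => birkhoffAverage ℝ T h n x - ∫ x, h x ∂μ) atTop (𝓝 0) := by
    refine ae_tendsto_zero_of_le_birkhoffAverage hT _ fun ε hε => ?_
    obtain ⟨u, hu, hhu⟩ := happ (ε / 3) (by positivity)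
    obtain ⟨K, d, hK, hA⟩ := hu.exists_average_close hT (ε := ε / 3) (by positivity)
    have hui := hu.integrable
    set m := ∫ y, u y ∂μ with hmdef
    set A : α → ℝ := fun x => (K : ℝ)⁻¹ * ∑ k ∈ Finset.range K, u (T^[k * d] x) with hAdef
    have hAm : Measurable A := measurable_const.mul (Finset.measurable_fun_sum _ fun k _ =>
      hu.measurable.comp (hT.iterate _).measurable)
    have hAi : Integrable A μ := (integrable_finsetSum _ fun k _ =>
      (hT.iterate (k * d)).integrable_comp_of_integrable hui).const_mul _
    have hmm : |m - ∫ x, h x ∂μ| ≤ ε / 3 := by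
      rw [abs_sub_comm, ← integral_sub hh hui]
      exact (abs_integral_le_integral_abs).trans hhu
    have i1 : Integrable (fun x => |h x - u x|) μ := (hh.sub hui).abs
    have i2 : Integrable (fun x => |A x - m|) μ := (hAi.sub (integrable_const m)).abs
    refine ⟨fun x => |h x - u x| + |A x - m| + |m - ∫ x, h x ∂μ|,
      fun n x => |birkhoffAverage ℝ T A n x - birkhoffAverage ℝ T u n x|,
      ((hm.sub hu.measurable).abs.add (hAm.sub measurable_const).abs).add measurable_const,
      (i1.add i2).add (integrable_const _), fun x => by positivity, ?_, fun x => ?_, ?_⟩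
    · have i3 : Integrable (fun x => |h x - u x| + |A x - m|) μ := i1.add i2
      rw [integral_add i3 (integrable_const _), integral_add i1 i2]
      simp only [integral_const, probReal_univ, one_smul]
      linarith
    · have hsum : ∀ n, birkhoffAverage ℝ T A n x - birkhoffAverage ℝ T u n x =
          (K : ℝ)⁻¹ * ∑ k ∈ Finset.range K,
            (birkhoffAverage ℝ T u n (T^[k * d] x) - birkhoffAverage ℝ T u n x) := by
        intro n
        have hK' : (K : ℝ) ≠ 0 := by exact_mod_cast hK.ne'
        rw [Finset.sum_sub_distrib, mul_sub, Finset.sum_const, Finset.card_range, nsmul_eq_mul,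
          inv_mul_cancel_left₀ hK']
        congr 1
        simp only [birkhoffAverage, birkhoffSum, hAdef, smul_eq_mul, ← Finset.mul_sum]
        rw [Finset.sum_comm, mul_left_comm]
        simp_rw [← Function.iterate_add_apply, Nat.add_comm]
      simp_rw [hsum]
      have := (tendsto_finsetSum (Finset.range K) fun k _ =>
        tendsto_birkhoffAverage_iterate_sub (T := T) hu.bounded (k * d) x).const_mul (K : ℝ)⁻¹
      simpa using this.abs
    · filter_upwards [eventually_gt_atTop 0] with n hn x
      have hn' : (0 : ℝ) < n := by exact_mod_cast hn
      -- Three terms of L¹ norm at most ε/3 each, minus a coboundary error; n > 0 is needed for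
      -- constants to average to themselves.
      have e1 : birkhoffAverage ℝ T h n x - ∫ x, h x ∂μ =
          birkhoffAverage ℝ T (fun x => (h x - u x) + (A x - m) + (m - ∫ x, h x ∂μ)) n x -
            (birkhoffAverage ℝ T A n x - birkhoffAverage ℝ T u n x) := by
        simp only [birkhoffAverage, birkhoffSum, smul_eq_mul, Finset.sum_add_distrib,
          Finset.sum_sub_distrib, Finset.sum_const, Finset.card_range, nsmul_eq_mul]
        field_simp
        ring
      rw [e1]
      refine (abs_sub _ _).trans (add_le_add_left ?_ _)
      simp only [birkhoffAverage, birkhoffSum, smul_eq_mul]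
      rw [abs_mul, abs_of_nonneg (inv_nonneg.2 hn'.le)]
      gcongr
      refine (Finset.abs_sum_le_sum_abs _ _).trans (Finset.sum_le_sum fun i _ => ?_)
      exact (abs_add_le _ _).trans (add_le_add_left (abs_add_le _ _) _)
  filter_upwards [main] with x hx
  simpa using hx.add_const (∫ x, h x ∂μ)

end Correlations

/-! ### Products and L¹ limits of mixing observables. -/

section Approximation

variable {α β : Type*} [MeasurableSpace α] [MeasurableSpace β]

/-- `a` is an integrable function that is an `L¹` limit of mixing observables. -/
structure IsMixingLimit (T : α → α) (μ : Measure α) (a : α → ℝ) : Prop where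
  measurable : Measurable a
  integrable : Integrable a μ
  exists_close : ∀ ε > 0, ∃ u, IsMixingObservable T μ u ∧ ∫ x, |a x - u x| ∂μ ≤ ε

theorem MeasureTheory.MeasurePreserving.integral_comp_of_measurable {μ : Measure α} {ν : Measure β}
    {T : α → β} (hT : MeasurePreserving T μ ν) {f : β → ℝ} (hf : Measurable f) :
    ∫ x, f (T x) ∂μ = ∫ y, f y ∂ν := by
  rw [← hT.map_eq, integral_map hT.measurable.aemeasurable hf.aestronglyMeasurable]

variable {μ : Measure α} {ν : Measure β} {T : α → α} {S : β → β}

/-- By Fubini, autocorrelations and squared means both multiply over the two factors. -/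
theorem IsMixingObservable.prod_mul [IsProbabilityMeasure μ] [IsProbabilityMeasure ν]
    {u : α → ℝ} {v : β → ℝ} (hu : IsMixingObservable T μ u) (hv : IsMixingObservable S ν v) :
    IsMixingObservable (Prod.map T S) (μ.prod ν) (fun p => u p.1 * v p.2) where
  measurable := (hu.measurable.comp measurable_fst).mul (hv.measurable.comp measurable_snd)
  bounded := by
    obtain ⟨K, hK⟩ := hu.bounded
    obtain ⟨L, hL⟩ := hv.bounded
    refine ⟨K * L, fun p => ?_⟩
    rw [abs_mul]
    exact mul_le_mul (hK _) (hL _) (abs_nonneg _) ((abs_nonneg _).trans (hK p.1))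
  tendsto := by
    rw [integral_prod_mul, mul_pow]
    convert hu.tendsto.mul hv.tendsto using 2 with n
    rw [← integral_prod_mul]
    refine integral_congr_ae (ae_of_all _ fun p => ?_)
    simp only [Prod.map_iterate, Prod.map_fst, Prod.map_snd]
    ring

theorem IsMixingLimit.prod_mul [IsProbabilityMeasure μ] [IsProbabilityMeasure ν]
    {a : α → ℝ} {b : β → ℝ} (ha : IsMixingLimit T μ a) (hb : IsMixingLimit S ν b) :
    IsMixingLimit (Prod.map T S) (μ.prod ν) (fun p => a p.1 * b p.2) where
  measurable := (ha.measurable.comp measurable_fst).mul (hb.measurable.comp measurable_snd)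
  integrable := ha.integrable.mul_prod hb.integrable
  exists_close := by
    intro ε hε
    have hb0 : 0 ≤ ∫ y, |b y| ∂ν := integral_nonneg fun _ => abs_nonneg _
    obtain ⟨u, hu, hau⟩ := ha.exists_close (ε / (2 * (1 + ∫ y, |b y| ∂ν))) (by positivity)
    have hu0 : 0 ≤ ∫ x, |u x| ∂μ := integral_nonneg fun _ => abs_nonneg _
    -- The choice of v comes after u, since its error is weighted by the L¹ norm of u.
    obtain ⟨v, hv, hbv⟩ := hb.exists_close (ε / (2 * (1 + ∫ x, |u x| ∂μ))) (by positivity)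
    refine ⟨_, hu.prod_mul hv, ?_⟩
    have i1 : Integrable (fun p : α × β => |a p.1 - u p.1| * |b p.2|) (μ.prod ν) :=
      ((ha.integrable.sub hu.integrable).abs).mul_prod hb.integrable.abs
    have i2 : Integrable (fun p : α × β => |u p.1| * |b p.2 - v p.2|) (μ.prod ν) :=
      hu.integrable.abs.mul_prod ((hb.integrable.sub hv.integrable).abs)
    calc ∫ p, |a p.1 * b p.2 - u p.1 * v p.2| ∂μ.prod ν
        ≤ ∫ p : α × β, (|a p.1 - u p.1| * |b p.2| + |u p.1| * |b p.2 - v p.2|) ∂μ.prod ν := by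
          refine integral_mono_of_nonneg (ae_of_all _ fun _ => abs_nonneg _) (i1.add i2)
            (ae_of_all _ fun p => ?_)
          simp only [← abs_mul]
          refine le_trans (le_of_eq ?_) (abs_add_le _ _)
          congr 1
          ring
      _ = (∫ x, |a x - u x| ∂μ) * ∫ y, |b y| ∂ν + (∫ x, |u x| ∂μ) * ∫ y, |b y - v y| ∂ν := by
          rw [integral_add i1 i2, integral_prod_mul (fun x => |a x - u x|) fun y => |b y|,
            integral_prod_mul (fun x => |u x|) fun y => |b y - v y|]
      _ ≤ ε / (2 * (1 + ∫ y, |b y| ∂ν)) * (1 + ∫ y, |b y| ∂ν) +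
          (1 + ∫ x, |u x| ∂μ) * (ε / (2 * (1 + ∫ x, |u x| ∂μ))) := by
          gcongr <;> linarith
      _ = ε := by field_simp; norm_num

/-- Weak dependence only tests functions bounded by one; scaling recovers truncations at any level.
-/
theorem IsMixingObservable.const_mul {u : α → ℝ} (hu : IsMixingObservable T μ u) (c : ℝ) :
    IsMixingObservable T μ (fun x => c * u x) where
  measurable := measurable_const.mul hu.measurable
  bounded := by
    obtain ⟨K, hK⟩ := hu.bounded
    exact ⟨|c| * K, fun x => by rw [abs_mul]; gcongr; exact hK x⟩
  tendsto := by
    rw [integral_const_mul, mul_pow]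
    convert hu.tendsto.const_mul (c ^ 2) using 2 with n
    rw [← integral_const_mul]
    congr 1 with x
    ring

theorem IsMixingLimit.of_dominated {a : α → ℝ} {u : ℕ → α → ℝ} (hm : Measurable a)
    (ha : Integrable a μ) (hu : ∀ n, IsMixingObservable T μ (u n)) (hle : ∀ n x, |u n x| ≤ |a x|)
    (hlim : ∀ x, Tendsto (fun n => u n x) atTop (𝓝 (a x))) : IsMixingLimit T μ a where
  measurable := hm
  integrable := ha
  exists_close := by
    intro ε hε
    have h0 : Tendsto (fun n => ∫ x, |a x - u n x| ∂μ) atTop (𝓝 (∫ _, (0 : ℝ) ∂μ)) := by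
      refine tendsto_integral_of_dominated_convergence (fun x => 2 * |a x|)
        (fun n => (hm.sub (hu n).measurable).abs.aestronglyMeasurable) (ha.abs.const_mul 2)
        (fun n => ae_of_all _ fun x => ?_) (ae_of_all _ fun x => ?_)
      · have := abs_sub (a x) (u n x)
        have := hle n x
        rw [Real.norm_eq_abs, abs_abs]
        linarith
      · simpa using ((hlim x).const_sub (a x)).abs
    rw [integral_zero] at h0
    obtain ⟨n, hn⟩ := (h0.eventually_le_const hε).exists
    exact ⟨u n, hu n, hn⟩

/-- Starting at T^j x absorbs sums beginning at time 1 and those translated by the lag. -/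
theorem IsMixingLimit.ae_tendsto [IsProbabilityMeasure μ] {a : α → ℝ}
    (ha : IsMixingLimit T μ a) (hT : MeasurePreserving T μ μ) (j : ℕ) :
    ∀ᵐ x ∂μ, Tendsto (fun n => birkhoffAverage ℝ T a n (T^[j] x)) atTop (𝓝 (∫ x, a x ∂μ)) :=
  (hT.iterate j).quasiMeasurePreserving.ae
    (ae_tendsto_birkhoffAverage hT ha.measurable ha.integrable ha.exists_close)

end Approximation

/-! ### Weakly dependent processes on path space. -/

section PathSpace

/-- The left shift on two-sided real sequences. -/
def pathShift (z : ℤ → ℝ) : ℤ → ℝ := fun i => z (i + 1)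

theorem measurable_pathShift : Measurable pathShift :=
  measurable_pi_lambda _ fun i => measurable_pi_apply (i + 1)

theorem pathShift_iterate (n : ℕ) (z : ℤ → ℝ) (i : ℤ) : pathShift^[n] z i = z (i + n) := by
  induction n generalizing i with
  | zero => simp
  | succ n ih =>
    rw [Function.iterate_succ_apply', pathShift, ih]
    push_cast
    congr 1
    ring

variable {Ω : Type*} [MeasurableSpace Ω] {μ : Measure Ω} {Z : ℤ → Ω → ℝ}

/-- The law on path space of a process indexed by `ℤ`. -/
noncomputable def pathLaw (μ : Measure Ω) (Z : ℤ → Ω → ℝ) : Measure (ℤ → ℝ) :=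
  μ.map fun ω i => Z i ω

theorem measurePreserving_path (hZ : ∀ i, Measurable (Z i)) :
    MeasurePreserving (fun ω i => Z i ω) μ (pathLaw μ Z) :=
  ⟨measurable_pi_lambda _ hZ, rfl⟩

theorem isProbabilityMeasure_pathLaw [IsProbabilityMeasure μ] (hZ : ∀ i, Measurable (Z i)) :
    IsProbabilityMeasure (pathLaw μ Z) :=
  Measure.isProbabilityMeasure_map (measurable_pi_lambda _ hZ).aemeasurable

theorem IsStrictlyStationary.measurePreserving (hZ : ∀ i, Measurable (Z i))
    (hs : IsStrictlyStationary μ Z) :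
    MeasurePreserving pathShift (pathLaw μ Z) (pathLaw μ Z) := by
  refine ⟨measurable_pathShift, ?_⟩
  rw [pathLaw, Measure.map_map measurable_pathShift (measurable_pi_lambda _ hZ)]
  exact hs 1

theorem lipCoeff_lt_top {p : ℕ} {f : (Fin p → ℝ) → ℝ} {L : ℝ} (hL : 0 ≤ L)
    (hf : ∀ x y, |f x - f y| ≤ L * ∑ i, |x i - y i|) : lipCoeff f < ⊤ := by
  refine lt_of_le_of_lt (b := ENNReal.ofReal L) ?_ ENNReal.ofReal_lt_top
  refine iSup_le fun x => iSup_le fun y => iSup_le fun _ => ENNReal.ofReal_le_ofReal ?_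
  exact div_le_of_le_mul₀ (Finset.sum_nonneg fun _ _ => abs_nonneg _) hL (hf x y)

/-- Bounded Lipschitz functions of two coordinates of a weakly dependent process are mixing. -/
theorem IsWeaklyDependent.isMixingObservable [IsProbabilityMeasure μ]
    (hZ : ∀ i, Measurable (Z i)) (hs : IsStrictlyStationary μ Z)
    {ψ : ℕ → ℕ → ℝ → ℝ → ℝ} {ε : ℕ → ℝ} (hd : IsWeaklyDependent μ Z ψ ε)
    {f : (Fin 2 → ℝ) → ℝ} (hfm : Measurable f) (hf1 : ∀ x, |f x| ≤ 1) {L : ℝ} (hL : 0 ≤ L)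
    (hf : ∀ x y, |f x - f y| ≤ L * ∑ i, |x i - y i|) (ℓ : ℕ) :
    IsMixingObservable pathShift (pathLaw μ Z) (fun z => f fun i => z (![0, (ℓ : ℤ)] i)) := by
  have hP := isProbabilityMeasure_pathLaw (μ := μ) hZ
  have hT := hs.measurePreserving hZ
  set s : Fin 2 → ℤ := ![0, (ℓ : ℤ)] with hsdef
  set U : (ℤ → ℝ) → ℝ := fun z => f fun i => z (s i) with hU
  have hUm : Measurable U := hfm.comp (measurable_pi_lambda _ fun i => measurable_pi_apply (s i))
  have hlip := lipCoeff_lt_top hL hf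
  have hsm : Monotone s := by
    intro i j hij
    fin_cases i <;> fin_cases j <;> simp [hsdef] at hij ⊢
  refine ⟨hUm, ⟨1, fun z => hf1 _⟩, ?_⟩
  have hUlp : MemLp U 2 (pathLaw μ Z) :=
    MemLp.of_bound hUm.aestronglyMeasurable 1 (ae_of_all _ fun z => hf1 _)
  have hcov : ∀ n, cov[fun ω => f (fun i => Z (s i) ω),
      fun ω => f (fun j => Z (s j + (n : ℕ)) ω); μ] =
      ∫ z, U z * U (pathShift^[n] z) ∂pathLaw μ Z - (∫ z, U z ∂pathLaw μ Z) ^ 2 := by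
    intro n
    have hTn := hT.iterate n
    have h1 := covariance_eq_sub hUlp (hUlp.comp_measurePreserving hTn)
    have h2 := hTn.integral_comp_of_measurable hUm
    have h3 := covariance_map_fun (μ := μ) (Z := fun ω i => Z i ω) (X := U)
      (Y := U ∘ pathShift^[n]) hUm.aestronglyMeasurable
      (hUm.comp hTn.measurable).aestronglyMeasurable (measurable_pi_lambda _ hZ).aemeasurable
    simp only [Function.comp_def, hU, pathShift_iterate] at h1 h2 h3 ⊢
    simp only [Pi.mul_apply] at h1
    rw [← h3]
    rw [pathLaw] at *
    rw [h1, h2, pow_two]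
  -- The first block of times ends at ℓ and the shifted block starts at n, leaving a gap n - ℓ. The
  -- factor ψ does not depend on n.
  have hbound : ∀ᶠ n in atTop, |∫ z, U z * U (pathShift^[n] z) ∂pathLaw μ Z -
      (∫ z, U z ∂pathLaw μ Z) ^ 2| ≤
      ψ 2 2 (lipCoeff f).toReal (lipCoeff f).toReal * ε (n - ℓ) := by
    filter_upwards [eventually_ge_atTop ℓ] with n hn
    rw [← hcov]
    refine hd.abs_cov_le 2 2 two_pos two_pos f f hf1 hf1 hlip hlip (n - ℓ) s
      (fun j => s j + n) hsm (fun i j hij => by simpa using hsm hij) fun i j => ?_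
    have h1 : s i ≤ ℓ := by fin_cases i <;> simp [hsdef]
    have h2 : 0 ≤ s j := by fin_cases j <;> simp [hsdef]
    push_cast [hn]
    linarith
  have h0 : Tendsto (fun n => ψ 2 2 (lipCoeff f).toReal (lipCoeff f).toReal * ε (n - ℓ)) atTop
      (𝓝 0) := by
    simpa using (hd.tendsto_zero.comp (tendsto_sub_atTop_nat ℓ)).const_mul
      (ψ 2 2 (lipCoeff f).toReal (lipCoeff f).toReal)
  have : Tendsto (fun n => ∫ z, U z * U (pathShift^[n] z) ∂pathLaw μ Z -
      (∫ z, U z ∂pathLaw μ Z) ^ 2) atTop (𝓝 0) := squeeze_zero_norm' hbound h0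
  exact tendsto_sub_nhds_zero_iff.1 this

/-- The truncation of `x / M` to `[-1, 1]`. -/
noncomputable def unitClamp (M x : ℝ) : ℝ := max (-1) (min 1 (x / M))

theorem measurable_unitClamp (M : ℝ) : Measurable (unitClamp M) :=
  measurable_const.max (measurable_const.min (measurable_id.div_const M))

theorem abs_unitClamp_le_one (M x : ℝ) : |unitClamp M x| ≤ 1 :=
  abs_le.2 ⟨le_max_left _ _, max_le (by norm_num) (min_le_left _ _)⟩

theorem abs_unitClamp_sub_le {M : ℝ} (hM : 1 ≤ M) (x y : ℝ) :
    |unitClamp M x - unitClamp M y| ≤ |x - y| := by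
  have h1 : |unitClamp M x - unitClamp M y| ≤ |x / M - y / M| := by
    unfold unitClamp
    rw [max_comm, max_comm (-1 : ℝ), min_comm, min_comm (1 : ℝ)]
    exact (abs_max_sub_max_le_abs _ _ _).trans (by
      simpa using abs_min_sub_min_le_max (x / M) 1 (y / M) 1)
  refine h1.trans ?_
  rw [← sub_div, abs_div, abs_of_pos (by linarith : 0 < M)]
  exact div_le_self (abs_nonneg _) hM

theorem abs_mul_unitClamp_le {M : ℝ} (hM : 1 ≤ M) (x : ℝ) : |M * unitClamp M x| ≤ |x| := by
  have hM0 : 0 < M := by linarith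
  have h : |unitClamp M x| ≤ |x / M| := by
    unfold unitClamp
    rw [abs_le]
    constructor
    · refine le_trans ?_ (le_max_right _ _)
      exact le_min ((neg_nonpos.2 (abs_nonneg _)).trans zero_le_one) (neg_abs_le _)
    · exact max_le ((by norm_num : (-1 : ℝ) ≤ 0).trans (abs_nonneg _))
        ((min_le_right _ _).trans (le_abs_self _))
  rw [abs_div, abs_of_pos hM0, le_div_iff₀ hM0] at h
  rw [abs_mul, abs_of_pos hM0, mul_comm]
  exact h

theorem mul_unitClamp_eq {M x : ℝ} (hM : 1 ≤ M) (hx : |x| ≤ M) : M * unitClamp M x = x := by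
  have hM0 : 0 < M := by linarith
  have := abs_le.1 hx
  unfold unitClamp
  rw [min_eq_right ((div_le_one hM0).2 this.2),
    max_eq_right ((le_div_iff₀ hM0).2 (by linarith)), mul_div_cancel₀ _ hM0.ne']

theorem tendsto_mul_unitClamp (x : ℝ) :
    Tendsto (fun n : ℕ => ((n : ℝ) + 1) * unitClamp ((n : ℝ) + 1) x) atTop (𝓝 x) := by
  obtain ⟨N, hN⟩ := exists_nat_ge |x|
  refine tendsto_const_nhds.congr' ?_
  filter_upwards [eventually_ge_atTop N] with n hn
  have : (N : ℝ) ≤ n := by exact_mod_cast hn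
  exact (mul_unitClamp_eq (by linarith [Nat.cast_nonneg (α := ℝ) n]) (by linarith)).symm

theorem memLp_two_pathLaw (hZ : ∀ i, Measurable (Z i)) (hs : IsStrictlyStationary μ Z)
    (h2 : MemLp (Z 0) 2 μ) (ℓ : ℕ) : MemLp (fun z => z ℓ) 2 (pathLaw μ Z) := by
  have h0 : MemLp (fun z : ℤ → ℝ => z 0) 2 (pathLaw μ Z) :=
    (memLp_map_measure_iff (measurable_pi_apply (0 : ℤ)).aestronglyMeasurable
      (measurable_pi_lambda _ hZ).aemeasurable).2 h2
  have := h0.comp_measurePreserving ((hs.measurePreserving hZ).iterate ℓ)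
  simpa [Function.comp_def, pathShift_iterate] using this

variable [IsProbabilityMeasure μ] {ψ : ℕ → ℕ → ℝ → ℝ → ℝ} {ε : ℕ → ℝ}

theorem IsWeaklyDependent.isMixingLimit_eval (hZ : ∀ i, Measurable (Z i))
    (hs : IsStrictlyStationary μ Z) (hd : IsWeaklyDependent μ Z ψ ε) (h2 : MemLp (Z 0) 2 μ) :
    IsMixingLimit pathShift (pathLaw μ Z) (fun z => z 0) := by
  have hP := isProbabilityMeasure_pathLaw (μ := μ) hZ
  have h1 : ∀ n : ℕ, (1 : ℝ) ≤ (n : ℝ) + 1 := fun n => by simp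
  refine IsMixingLimit.of_dominated
    (u := fun n z => ((n : ℝ) + 1) * unitClamp ((n : ℝ) + 1) (z 0)) (measurable_pi_apply 0)
    ((memLp_two_pathLaw hZ hs h2 0).integrable (by norm_num))
    (fun n => ?_) (fun n z => abs_mul_unitClamp_le (h1 n) _) fun z => tendsto_mul_unitClamp _
  -- A single coordinate is treated as a pair at lag 0 whose second entry is ignored.
  refine (hd.isMixingObservable hZ hs (f := fun x => unitClamp ((n : ℝ) + 1) (x 0))
    ((measurable_unitClamp _).comp (measurable_pi_apply _)) (fun x => abs_unitClamp_le_one _ _)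
    zero_le_one (fun x y => ?_) 0).const_mul _
  refine (abs_unitClamp_sub_le (h1 n) _ _).trans ?_
  rw [one_mul, Fin.sum_univ_two]
  linarith [abs_nonneg (x 1 - y 1)]

theorem IsWeaklyDependent.isMixingLimit_mul (hZ : ∀ i, Measurable (Z i))
    (hs : IsStrictlyStationary μ Z) (hd : IsWeaklyDependent μ Z ψ ε) (h2 : MemLp (Z 0) 2 μ)
    (ℓ : ℕ) : IsMixingLimit pathShift (pathLaw μ Z) (fun z => z 0 * z ℓ) := by
  have hP := isProbabilityMeasure_pathLaw (μ := μ) hZ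
  have h1 : ∀ n : ℕ, (1 : ℝ) ≤ (n : ℝ) + 1 := fun n => by simp
  refine IsMixingLimit.of_dominated
    (u := fun n z => (((n : ℝ) + 1) * ((n : ℝ) + 1)) *
      (unitClamp ((n : ℝ) + 1) (z 0) * unitClamp ((n : ℝ) + 1) (z ℓ)))
    ((measurable_pi_apply 0).mul (measurable_pi_apply (ℓ : ℤ)))
    ((memLp_two_pathLaw hZ hs h2 0).integrable_mul (memLp_two_pathLaw hZ hs h2 ℓ))
    (fun n => ?_) (fun n z => ?_) fun z => ?_
  · refine (hd.isMixingObservable hZ hs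
      (f := fun x => unitClamp ((n : ℝ) + 1) (x 0) * unitClamp ((n : ℝ) + 1) (x 1))
      (((measurable_unitClamp _).comp (measurable_pi_apply _)).mul
        ((measurable_unitClamp _).comp (measurable_pi_apply _))) (fun x => ?_)
      zero_le_one (fun x y => ?_) ℓ).const_mul _
    · rw [abs_mul]
      exact mul_le_one₀ (abs_unitClamp_le_one _ _) (abs_nonneg _) (abs_unitClamp_le_one _ _)
    · rw [one_mul, Fin.sum_univ_two]
      set c := unitClamp ((n : ℝ) + 1)
      have hc : c (x 0) * c (x 1) - c (y 0) * c (y 1) =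
          (c (x 0) - c (y 0)) * c (x 1) + c (y 0) * (c (x 1) - c (y 1)) := by ring
      rw [hc]
      refine (abs_add_le _ _).trans (add_le_add ?_ ?_)
      · rw [abs_mul]
        exact (mul_le_of_le_one_right (abs_nonneg _) (abs_unitClamp_le_one _ _)).trans
          (abs_unitClamp_sub_le (h1 n) _ _)
      · rw [abs_mul]
        exact (mul_le_of_le_one_left (abs_nonneg _) (abs_unitClamp_le_one _ _)).trans
          (abs_unitClamp_sub_le (h1 n) _ _)
  · rw [mul_mul_mul_comm, abs_mul, abs_mul (z 0)]
    exact mul_le_mul (abs_mul_unitClamp_le (h1 n) _) (abs_mul_unitClamp_le (h1 n) _)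
      (abs_nonneg _) (abs_nonneg _)
  · exact ((tendsto_mul_unitClamp _).mul (tendsto_mul_unitClamp _)).congr fun n =>
      mul_mul_mul_comm _ _ _ _

end PathSpace

/-! ### Consistency of the Parzen estimator. -/

theorem memLp_two_of_integrable_abs_rpow {Ω : Type*} [MeasurableSpace Ω] {μ : Measure Ω}
    [IsFiniteMeasure μ] {f : Ω → ℝ} (hf : Measurable f) {p : ℝ} (hp : 2 ≤ p)
    (hi : Integrable (fun ω => |f ω| ^ p) μ) : MemLp f 2 μ := by
  rw [memLp_two_iff_integrable_sq hf.aestronglyMeasurable]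
  refine ((integrable_const (1 : ℝ)).add hi).mono' (hf.pow_const 2).aestronglyMeasurable
    (ae_of_all _ fun ω => ?_)
  rw [Real.norm_eq_abs, abs_of_nonneg (sq_nonneg _), ← sq_abs]
  change |f ω| ^ 2 ≤ 1 + |f ω| ^ p
  have h0 := Real.rpow_nonneg (abs_nonneg (f ω)) p
  rcases le_total |f ω| 1 with h | h
  · nlinarith [abs_nonneg (f ω)]
  · have := Real.rpow_le_rpow_of_exponent_le h hp
    rw [Real.rpow_two] at this
    linarith

theorem sum_Icc_one_eq_sum_range (g : ℤ → ℝ) (n : ℕ) :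
    ∑ i ∈ Finset.Icc 1 n, g (i : ℤ) = ∑ k ∈ Finset.range n, g ((k : ℤ) + 1) := by
  induction n with
  | zero => simp
  | succ n ih =>
    rw [Finset.sum_Icc_succ_top (by omega), Finset.sum_range_succ, ih]
    simp

/-- Convergence of the Parzen estimator along a path, from the convergence of the averages that
it is composed of. -/
theorem tendsto_parzenEstimator {Ω : Type*} (X C : ℤ → Ω → ℝ) (ℓ : ℕ) (ω : Ω) {g ν : ℝ}
    (hν : ν ≠ 0)
    (h1 : Tendsto (fun n : ℕ => (n : ℝ)⁻¹ * ∑ i ∈ Finset.Icc 1 n,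
      (X i ω * X ((i : ℤ) + ℓ) ω) * (C i ω * C ((i : ℤ) + ℓ) ω)) atTop (𝓝 (g * ν)))
    (h2 : Tendsto (fun n : ℕ => (n : ℝ)⁻¹ * ∑ i ∈ Finset.Icc 1 n, X i ω * C i ω) atTop (𝓝 0))
    (h3 : Tendsto (fun n : ℕ => (n : ℝ)⁻¹ * ∑ i ∈ Finset.Icc 1 n,
      X ((i : ℤ) + ℓ) ω * C ((i : ℤ) + ℓ) ω) atTop (𝓝 0))
    (h4 : Tendsto (fun n : ℕ => (n : ℝ)⁻¹ * ∑ i ∈ Finset.Icc 1 n,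
      C i ω * C ((i : ℤ) + ℓ) ω) atTop (𝓝 ν)) :
    Tendsto (fun N : ℕ => parzenEstimator X C ℓ N ω) atTop (𝓝 g) := by
  -- Writing N = n + ℓ turns the truncated difference N - ℓ into n.
  rw [← tendsto_add_atTop_iff_nat ℓ]
  set m : ℕ → ℝ := fun N => sampleMean (fun i ω => C i ω * X i ω) N ω with hm
  have hm0 : Tendsto (fun n => m (n + ℓ)) atTop (𝓝 0) := by
    rw [tendsto_add_atTop_iff_nat ℓ]
    refine h2.congr fun n => ?_
    simp only [hm, sampleMean, div_eq_inv_mul, mul_comm (X _ ω)]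
  have hlim := ((h1.sub (hm0.mul (h2.add h3))).add (hm0.mul hm0)).div h4 hν
  have hg : (g * ν - 0 * (0 + 0) + 0 * 0) / ν = g := by field_simp; ring
  rw [hg] at hlim
  refine hlim.congr' ?_
  filter_upwards [eventually_gt_atTop 0] with n hn
  have hn' : (n : ℝ) ≠ 0 := by exact_mod_cast hn.ne'
  simp only [parzenEstimator, Nat.add_sub_cancel]
  change _ / _ = (∑ i ∈ Finset.Icc 1 n, (C i ω * X i ω - m (n + ℓ)) *
    (C ((i : ℤ) + ℓ) ω * X ((i : ℤ) + ℓ) ω - m (n + ℓ))) / _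
  have hnum : ∑ i ∈ Finset.Icc 1 n, (C i ω * X i ω - m (n + ℓ)) *
      (C ((i : ℤ) + ℓ) ω * X ((i : ℤ) + ℓ) ω - m (n + ℓ)) =
      ∑ i ∈ Finset.Icc 1 n, (X i ω * X ((i : ℤ) + ℓ) ω) * (C i ω * C ((i : ℤ) + ℓ) ω) -
        m (n + ℓ) * (∑ i ∈ Finset.Icc 1 n, X i ω * C i ω +
          ∑ i ∈ Finset.Icc 1 n, X ((i : ℤ) + ℓ) ω * C ((i : ℤ) + ℓ) ω) +
        n * (m (n + ℓ) * m (n + ℓ)) := by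
    have hc : (n : ℝ) * (m (n + ℓ) * m (n + ℓ)) =
        ∑ i ∈ Finset.Icc 1 n, m (n + ℓ) * m (n + ℓ) := by simp
    rw [hc, ← Finset.sum_add_distrib, Finset.mul_sum, ← Finset.sum_sub_distrib,
      ← Finset.sum_add_distrib]
    refine Finset.sum_congr rfl fun i _ => ?_
    ring
  rw [hnum, ← mul_div_mul_left _ (∑ i ∈ _, _) (inv_ne_zero hn')]
  congr 1
  field_simp

/-- Strong consistency of the Parzen estimator for square integrable weakly dependent processes,
without any rate on the dependence coefficients. -/
theorem ae_tendsto_parzenEstimator {Ω : Type*} [MeasurableSpace Ω] {μ : Measure Ω}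
    [IsProbabilityMeasure μ] {X C : ℤ → Ω → ℝ}
    (hXmeas : ∀ i, Measurable (X i)) (hCmeas : ∀ i, Measurable (C i))
    (hXstat : IsStrictlyStationary μ X) (hCstat : IsStrictlyStationary μ C)
    (hXmean : ∫ ω, X 0 ω ∂μ = 0)
    (hindep : IndepFun (fun ω (i : ℤ) => X i ω) (fun ω (i : ℤ) => C i ω) μ)
    (hX2 : MemLp (X 0) 2 μ) (hC2 : MemLp (C 0) 2 μ)
    {ψX ψC : ℕ → ℕ → ℝ → ℝ → ℝ} {εX εC : ℕ → ℝ}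
    (hX : IsWeaklyDependent μ X ψX εX) (hC : IsWeaklyDependent μ C ψC εC)
    (ℓ : ℕ) (hν : ∫ ω, C 0 ω * C (ℓ : ℤ) ω ∂μ ≠ 0) :
    ∀ᵐ ω ∂μ, Tendsto (fun N : ℕ => parzenEstimator X C ℓ N ω) atTop
      (𝓝 (cov[X 0, X (ℓ : ℤ); μ])) := by
  have hPX := isProbabilityMeasure_pathLaw (μ := μ) hXmeas
  have hPC := isProbabilityMeasure_pathLaw (μ := μ) hCmeas
  have hpX := measurePreserving_path (μ := μ) hXmeas
  have hpC := measurePreserving_path (μ := μ) hCmeas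
  have hTX := hXstat.measurePreserving hXmeas
  have hTC := hCstat.measurePreserving hCmeas
  have hT := hTX.prod hTC
  -- Independence enters here: the joint path law is the product measure.
  have hpair : MeasurePreserving (fun ω => ((fun i : ℤ => X i ω), fun i : ℤ => C i ω)) μ
      ((pathLaw μ X).prod (pathLaw μ C)) :=
    ⟨hpX.measurable.prodMk hpC.measurable,
      (indepFun_iff_map_prod_eq_prod_map_map hpX.measurable.aemeasurable
        hpC.measurable.aemeasurable).1 hindep⟩
  have aX1 := hX.isMixingLimit_eval hXmeas hXstat hX2
  have aX2 := hX.isMixingLimit_mul hXmeas hXstat hX2 ℓ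
  have aC1 := hC.isMixingLimit_eval hCmeas hCstat hC2
  have aC2 := hC.isMixingLimit_mul hCmeas hCstat hC2 ℓ
  have eX1 : ∫ z, z 0 ∂pathLaw μ X = 0 :=
    (hpX.integral_comp_of_measurable aX1.measurable).symm.trans hXmean
  have eX2 : ∫ z, z 0 * z ℓ ∂pathLaw μ X = cov[X 0, X (ℓ : ℤ); μ] := by
    have hXl : MemLp (X ℓ) 2 μ :=
      (memLp_two_pathLaw hXmeas hXstat hX2 ℓ).comp_measurePreserving hpX
    rw [covariance_eq_sub hX2 hXl, hXmean, zero_mul, sub_zero]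
    exact (hpX.integral_comp_of_measurable aX2.measurable).symm
  have eC2 : ∫ z, z 0 * z ℓ ∂pathLaw μ C = ∫ ω, C 0 ω * C (ℓ : ℤ) ω ∂μ :=
    (hpC.integral_comp_of_measurable aC2.measurable).symm
  have l1 := hpair.quasiMeasurePreserving.ae ((aX2.prod_mul aC2).ae_tendsto hT 1)
  have l2 := hpair.quasiMeasurePreserving.ae ((aX1.prod_mul aC1).ae_tendsto hT 1)
  have l3 := hpair.quasiMeasurePreserving.ae ((aX1.prod_mul aC1).ae_tendsto hT (ℓ + 1))
  have l4 := hpC.quasiMeasurePreserving.ae (aC2.ae_tendsto hTC 1)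
  rw [integral_prod_mul (fun z : ℤ → ℝ => z 0 * z ℓ) (fun z : ℤ → ℝ => z 0 * z ℓ), eX2, eC2] at l1
  rw [integral_prod_mul (fun z : ℤ → ℝ => z 0) (fun z : ℤ → ℝ => z 0), eX1, zero_mul] at l2 l3
  rw [eC2] at l4
  filter_upwards [l1, l2, l3, l4] with ω k1 k2 k3 k4
  simp only [birkhoffAverage, birkhoffSum, ← Function.iterate_add_apply, Prod.map_iterate,
    Prod.map_apply, pathShift_iterate, smul_eq_mul] at k1 k2 k3 k4
  refine tendsto_parzenEstimator X C ℓ ω hν (k1.congr fun n => ?_) (k2.congr fun n => ?_)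
    (k3.congr fun n => ?_) (k4.congr fun n => ?_)
  · rw [sum_Icc_one_eq_sum_range
      (fun i => (X i ω * X (i + ℓ) ω) * (C i ω * C (i + ℓ) ω))]
    simp [add_comm, add_left_comm]
  · rw [sum_Icc_one_eq_sum_range (fun i => X i ω * C i ω)]
    simp [add_left_comm]
  · rw [sum_Icc_one_eq_sum_range (fun i => X (i + ℓ) ω * C (i + ℓ) ω)]
    simp [add_comm, add_left_comm]
  · rw [sum_Icc_one_eq_sum_range (fun i => C i ω * C (i + ℓ) ω)]
    simp [add_comm, add_assoc]

theorem mainTheorem3 {Ω : Type*} [MeasurableSpace Ω] (μ : Measure Ω) [IsProbabilityMeasure μ]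
    (X C : ℤ → Ω → ℝ)
    (hXmeas : ∀ i, Measurable (X i)) (hCmeas : ∀ i, Measurable (C i))
    (hXstat : IsStrictlyStationary μ X) (hCstat : IsStrictlyStationary μ C)
    (hXmean : ∫ ω, X 0 ω ∂μ = 0)
    (hCbdd : ∃ B : ℝ, ∀ i, ∀ᵐ ω ∂μ, 0 ≤ C i ω ∧ C i ω ≤ B)
    (hindep : IndepFun (fun ω (i : ℤ) => X i ω) (fun ω (i : ℤ) => C i ω) μ)
    (hdep :
      -- `θ`-weak dependence
      (∃ (δ r : ℝ) (θX θC : ℕ → ℝ), 0 < δ ∧ 1 + δ < r ∧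
        Integrable (fun ω => |X 0 ω| ^ (2 + δ)) μ ∧
        IsWeaklyDependent μ X psiTheta θX ∧ IsWeaklyDependent μ C psiTheta θC ∧
        Summable (fun i : ℕ =>
          (i : ℝ) ^ ((r * (δ - 1) + 1) / (r - (1 + δ))) * θX i ^ (δ / (δ + 1))) ∧
        Summable (fun i : ℕ =>
          (i : ℝ) ^ ((r * (δ - 1) + 1) / (r - (1 + δ))) * θC i ^ (δ / (δ + 1)))) ∨
      -- `κ`-weak dependence
      (∃ (m κ : ℝ) (κX κC : ℕ → ℝ), 4 < m ∧ m / (m - 2) * (2 + 1 / (m - 2)) < κ ∧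
        Integrable (fun ω => |X 0 ω| ^ m) μ ∧
        IsWeaklyDependent μ X psiKappa κX ∧ IsWeaklyDependent μ C psiKappa κC ∧
        κX =O[atTop] (fun n : ℕ => (n : ℝ) ^ (-κ)) ∧
        κC =O[atTop] (fun n : ℕ => (n : ℝ) ^ (-κ))) ∨
      -- `λ`-weak dependence
      (∃ (m lam : ℝ) (lamX lamC : ℕ → ℝ), 4 < m ∧ m / (m - 2) * (4 + 1 / (m - 2)) < lam ∧
        Integrable (fun ω => |X 0 ω| ^ m) μ ∧
        IsWeaklyDependent μ X psiLambda lamX ∧ IsWeaklyDependent μ C psiLambda lamC ∧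
        lamX =O[atTop] (fun n : ℕ => (n : ℝ) ^ (-lam)) ∧
        lamC =O[atTop] (fun n : ℕ => (n : ℝ) ^ (-lam))))
    (ℓ : ℕ) (hν : 0 < ∫ ω, C 0 ω * C (ℓ : ℤ) ω ∂μ) :
    ∀ᵐ ω ∂μ, Tendsto (fun N : ℕ => parzenEstimator X C ℓ N ω) atTop
      (𝓝 (cov[X 0, X (ℓ : ℤ); μ])) := by
  obtain ⟨B, hB⟩ := hCbdd
  have hC2 : MemLp (C 0) 2 μ :=
    MemLp.of_bound (hCmeas 0).aestronglyMeasurable B <| by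
      filter_upwards [hB 0] with ω hω
      rw [Real.norm_eq_abs, abs_of_nonneg hω.1]
      exact hω.2
  rcases hdep with ⟨δ, r, θX, θC, hδ, -, hi, hX, hC, -, -⟩ | ⟨m, κ, κX, κC, hm, -, hi, hX, hC, -, -⟩ |
    ⟨m, lam, lamX, lamC, hm, -, hi, hX, hC, -, -⟩
  · exact ae_tendsto_parzenEstimator hXmeas hCmeas hXstat hCstat hXmean hindep
      (memLp_two_of_integrable_abs_rpow (hXmeas 0) (by linarith) hi) hC2 hX hC ℓ hν.ne'
  · exact ae_tendsto_parzenEstimator hXmeas hCmeas hXstat hCstat hXmean hindep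
      (memLp_two_of_integrable_abs_rpow (hXmeas 0) (by linarith) hi) hC2 hX hC ℓ hν.ne'
  · exact ae_tendsto_parzenEstimator hXmeas hCmeas hXstat hCstat hXmean hindep
      (memLp_two_of_integrable_abs_rpow (hXmeas 0) (by linarith) hi) hC2 hX hC ℓ hν.ne'
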